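/- Let $d\ge 2$, let $U$ be a unitary operator on $\mathbb{C}^d$ and let $\Pi=\{\Pi_1,\Pi_2\}$ be a projection-valued measure on $\mathbb{C}^d$ (orthogonal projections with $\Pi_1+\Pi_2=\mathbb{I}$) such that $\operatorname{rank}\Pi_1=d-1$ and $\operatorname{rank}\Pi_2=1$. Let $z$ be a unit vector that spans $\operatorname{im}\Pi_2$ and put $\Theta:=\operatorname{im}\Pi_1=\operatorname{span}\{z\}^{\perp}$. Let $\mathbb{P}_*$ be the probability measure on $\{1,2\}^{\mathbb{N}}$ (with the $\sigma$-algebra generated by the cylinder sets) of the sequence of outcomes when a system that starts in the maximally mixed state $\rho_*=\mathbb{I}/d$ repeatedly evolves by $U$ and is then measured with $\Pi$; that is, the unique probability measure with $$\mathbb{P}_*(\{s: s_1=i_1,\ldots,s_n=i_n\})=\operatorname{tr}\bigl(\sqrt{\Pi_{i_n}}\,U\cdots\sqrt{\Pi_{i_1}}\,U\,\rho_*\,U^*\sqrt{\Pi_{i_1}}\cdots U^*\sqrt{\Pi_{i_n}}\bigr)$$ for all $(i_1,\ldots,i_n)\in\{1,2\}^n$, $n\in\mathbb{N}$ (here $\sqrt{\Pi_i}=\Pi_i$).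 The following conditions are equivalent: (i) $\mathbb{P}_*$ is not ergodic (with respect to the left shift); (ii) there exists a non-trivial subspace of $\mathbb{C}^d$ (different from $\{0\}$ and $\mathbb{C}^d$) that is invariant under $U$ and under $\Pi_2$ (and thus necessarily also under $\Pi_1$); (iii) $z$ belongs to a non-trivial subspace of $\mathbb{C}^d$ that is invariant under $U$; (iv) an eigenvector of $U$ belongs to $\Theta$. Moreover, the limit below exists and $$\mathbb{P}_*\bigl(\{s: s_i=1\text{ for all but finitely many } i\}\bigr)=\tfrac1d\lim_{m\to\infty}\operatorname{tr}\bigl((\Pi_1U)^m(\Pi_1U)^{*m}\bigr).$$ -/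

import Mathlib

open MeasureTheory Filter Topology
open scoped ComplexOrder MatrixOrder ENNReal

namespace RepeatedMeasurement

section Sequences

variable {α : Type*}

/-- The cylinder set of the sequences that begin with the string `ι`. -/
def cylinder (ι : List α) : Set (ℕ → α) :=
  {s | ∀ i : Fin ι.length, s i = ι.get i}

/-- The left shift on sequences. -/
def shift (s : ℕ → α) : ℕ → α := fun n => s (n + 1)

theorem mem_cylinder {ι : List α} {s : ℕ → α} :
    s ∈ cylinder ι ↔ ∀ (i : ℕ) (h : i < ι.length), s i = ι[i] := by
  simp [cylinder, Fin.forall_iff]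

theorem cylinder_append_subset (ι κ : List α) : cylinder (ι ++ κ) ⊆ cylinder ι := by
  intro s hs
  rw [mem_cylinder] at hs ⊢
  intro i hi
  rw [hs i (by simp; omega), List.getElem_append_left]

theorem cylinder_subset_of_mem {ι κ : List α} {s : ℕ → α} (hι : s ∈ cylinder ι)
    (hκ : s ∈ cylinder κ) (h : ι.length ≤ κ.length) : cylinder κ ⊆ cylinder ι := by
  intro t ht
  rw [mem_cylinder] at *
  intro i hi
  rw [ht i (hi.trans_le h), ← hκ i (hi.trans_le h), hι i hi]

theorem disjoint_cylinder (ι κ : List α) {a b : α} (hab : a ≠ b) :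
    Disjoint (cylinder (ι ++ [a])) (cylinder (ι ++ b :: κ)) := by
  rw [Set.disjoint_left]
  intro s ha hb
  rw [mem_cylinder] at ha hb
  have h1 := ha ι.length (by simp)
  have h2 := hb ι.length (by simp)
  simp at h1 h2
  exact hab (h1.symm.trans h2)

theorem isPiSystem_cylinder : IsPiSystem (Set.range (cylinder (α := α))) := by
  rintro _ ⟨ι, rfl⟩ _ ⟨κ, rfl⟩ ⟨s, hι, hκ⟩
  rcases le_total ι.length κ.length with h | h
  · exact ⟨κ, (Set.inter_eq_right.2 (cylinder_subset_of_mem hι hκ h)).symm⟩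
  · exact ⟨ι, (Set.inter_eq_left.2 (cylinder_subset_of_mem hκ hι h)).symm⟩

theorem measurableSet_cylinder [MeasurableSpace α] [MeasurableSingletonClass α] (ι : List α) :
    MeasurableSet (cylinder ι) := by
  have : cylinder ι = ⋂ i : Fin ι.length, (fun s : ℕ → α => s i) ⁻¹' {ι.get i} := by
    ext s; simp [cylinder]
  rw [this]
  exact MeasurableSet.iInter fun i => measurable_pi_apply _ (measurableSet_singleton _)

/-- The product σ-algebra on sequences is the one generated by the cylinder sets. -/
theorem generateFrom_cylinder [Finite α] [MeasurableSpace α] [MeasurableSingletonClass α] :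
    (MeasurableSpace.pi : MeasurableSpace (ℕ → α)) =
      MeasurableSpace.generateFrom (Set.range (cylinder (α := α))) := by
  apply le_antisymm
  · refine iSup_le fun n => ?_
    rintro _ ⟨t, -, rfl⟩
    have : (fun s : ℕ → α => s n) ⁻¹' t =
        ⋃ f ∈ {f : Fin (n + 1) → α | f (Fin.last n) ∈ t}, cylinder (List.ofFn f) := by
      ext s
      simp only [Set.mem_preimage, Set.mem_ofPred_eq, Set.mem_iUnion, mem_cylinder, exists_prop]
      constructor
      · intro hs
        exact ⟨fun i => s i, by simpa using hs, fun i hi => by rw [List.getElem_ofFn]⟩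
      · rintro ⟨f, hf, hs⟩
        have h := hs n (by simp)
        rw [h, List.getElem_ofFn]
        exact hf
    rw [this]
    exact MeasurableSet.biUnion (Set.to_countable _)
      fun f _ => MeasurableSpace.measurableSet_generateFrom ⟨_, rfl⟩
  · refine MeasurableSpace.generateFrom_le ?_
    rintro _ ⟨ι, rfl⟩
    exact measurableSet_cylinder ι

/-- A finite measure on sequences is determined by its values on the cylinder sets. -/
theorem measure_ext_cylinder [Finite α] [MeasurableSpace α] [MeasurableSingletonClass α]
    {μ ν : Measure (ℕ → α)} [IsFiniteMeasure μ] (h : ∀ ι, μ (cylinder ι) = ν (cylinder ι)) :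
    μ = ν := by
  refine ext_of_generate_finite _ generateFrom_cylinder isPiSystem_cylinder ?_ ?_
  · rintro _ ⟨ι, rfl⟩
    exact h ι
  · have : cylinder ([] : List α) = Set.univ := by ext s; simp [mem_cylinder]
    rw [← this]; exact h []

/-- The discrete measure with mass `q κ` at one point of `cylinder κ`, for each string `κ` that
extends `ι` by `n` further symbols. -/
noncomputable def discreteApprox [Fintype α] [Inhabited α] [MeasurableSpace α]
    (q : List α → ℝ≥0∞) : ℕ → List α → Measure (ℕ → α)
  | 0, ι => q ι • Measure.dirac fun i => ι.getD i default
  | n + 1, ι => ∑ a : α, discreteApprox q n (ι ++ [a])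

theorem discreteApprox_univ [Fintype α] [Inhabited α] [MeasurableSpace α] {q : List α → ℝ≥0∞}
    (hq : ∀ ι, ∑ a : α, q (ι ++ [a]) = q ι) (n : ℕ) (ι : List α) :
    discreteApprox q n ι Set.univ = q ι := by
  induction n generalizing ι with
  | zero => simp [discreteApprox]
  | succ n ih => simp [discreteApprox, ih, hq]

variable [Fintype α] [MeasurableSpace α] [MeasurableSingletonClass α]

theorem discreteApprox_compl [Inhabited α] (q : List α → ℝ≥0∞) (n : ℕ) (ι : List α) :
    discreteApprox q n ι (cylinder ι)ᶜ = 0 := by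
  induction n generalizing ι with
  | zero =>
    have : (fun i => ι.getD i default) ∈ cylinder ι := by
      rw [mem_cylinder]; intro i hi; simp [hi]
    rw [discreteApprox, Measure.smul_apply,
      Measure.dirac_apply' _ (measurableSet_cylinder ι).compl,
      Set.indicator_of_notMem (by simpa using this), smul_zero]
  | succ n ih =>
    simp only [discreteApprox, Measure.coe_finsetSum, Finset.sum_apply]
    exact Finset.sum_eq_zero fun a _ => measure_mono_null
      (Set.compl_subset_compl.2 (cylinder_append_subset ι [a])) (ih (ι ++ [a]))

theorem discreteApprox_cylinder [Inhabited α] {q : List α → ℝ≥0∞}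
    (hq : ∀ ι, ∑ a : α, q (ι ++ [a]) = q ι) (n : ℕ) (ι κ : List α) (h : κ.length ≤ n) :
    discreteApprox q n ι (cylinder (ι ++ κ)) = q (ι ++ κ) := by
  induction κ generalizing n ι with
  | nil =>
    rw [List.append_nil, measure_of_measure_compl_eq_zero (discreteApprox_compl q n ι),
      discreteApprox_univ hq]
  | cons b κ ih =>
    obtain ⟨n, rfl⟩ : ∃ m, n = m + 1 := ⟨n - 1, by simp at h; omega⟩
    simp only [discreteApprox, Measure.coe_finsetSum, Finset.sum_apply]
    rw [Finset.sum_eq_single b]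
    · simpa using ih n (ι ++ [b]) (by simpa using h)
    · intro a _ hab
      exact measure_mono_null (Set.disjoint_left.1 (disjoint_cylinder ι κ hab).symm)
        (discreteApprox_compl q n (ι ++ [a]))
    · simp

/-- Kolmogorov extension over a finite alphabet: a consistent family of string probabilities comes
from a probability measure on sequences. -/
theorem exists_measure_cylinder (q : List α → ℝ≥0∞) (h1 : q [] = 1)
    (hq : ∀ ι, ∑ a : α, q (ι ++ [a]) = q ι) :
    ∃ μ : Measure (ℕ → α), IsProbabilityMeasure μ ∧ ∀ ι, μ (cylinder ι) = q ι := by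
  have hne : Nonempty α := by
    by_contra h
    rw [not_nonempty_iff] at h
    simpa [h1] using hq []
  let _ : Inhabited α := Classical.inhabited_of_nonempty hne
  let _ : TopologicalSpace α := ⊥
  have : DiscreteTopology α := ⟨rfl⟩
  have : BorelSpace α := ⟨by
    ext s
    rw [borel_eq_top_of_discrete]
    exact ⟨fun _ => trivial, fun _ => s.toFinite.measurableSet⟩⟩
  let ν : ℕ → ProbabilityMeasure (ℕ → α) := fun n =>
    ⟨discreteApprox q n [], ⟨by rw [discreteApprox_univ hq, h1]⟩⟩
  obtain ⟨μ, -, hμ⟩ := (isCompact_univ (X := ProbabilityMeasure (ℕ → α))).ultrafilter_le_nhds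
    (Ultrafilter.map ν (hyperfilter ℕ)) (by simp)
  have hlim : Tendsto ν (hyperfilter ℕ) (𝓝 μ) := hμ
  refine ⟨μ, inferInstance, fun ι => ?_⟩
  have hclopen : IsClopen (cylinder ι) := by
    have : cylinder ι = ⋂ i : Fin ι.length, (fun s : ℕ → α => s i) ⁻¹' {ι.get i} := by
      ext s; simp [cylinder]
    rw [this]
    exact isClopen_iInter_of_finite fun i => (isClopen_discrete _).preimage (continuous_apply _)
  have h := ProbabilityMeasure.tendsto_measure_of_null_frontier_of_tendsto' hlim
    (E := cylinder ι) (by simp [hclopen.frontier_eq])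
  refine tendsto_nhds_unique h (tendsto_const_nhds.congr' ?_)
  have hev : ∀ᶠ n in (hyperfilter ℕ : Filter ℕ), ι.length ≤ n :=
    Nat.hyperfilter_le_atTop (eventually_ge_atTop _)
  filter_upwards [hev] with n hn
  exact (discreteApprox_cylinder hq n [] ι hn).symm

end Sequences

/-- A measurement of a `d`-dimensional quantum system with outcomes in `Fin k`: a positive
operator-valued measure, that is, non-zero positive semi-definite operators on `ℂ^d` that sum to the
identity. -/
structure POVM (d k : ℕ) where
  op : Fin k → Matrix (Fin d) (Fin d) ℂ
  posSemidef : ∀ i, (op i).PosSemidef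
  ne_zero : ∀ i, op i ≠ 0
  sum_eq_one : ∑ i, op i = 1

namespace POVM

variable {d k : ℕ}

/-- A projection-valued measure: every measurement operator is a projection (an orthogonal one,
since it is self-adjoint). -/
def IsPVM (M : POVM d k) : Prop := ∀ i, IsIdempotentElem (M.op i)

/-- The unnormalised state `√Πᵢ U ρ U* √Πᵢ` after the evolution `U` and the outcome `i`. -/
noncomputable def evolve (M : POVM d k) (U : Matrix.unitaryGroup (Fin d) ℂ) (i : Fin k)
    (ρ : Matrix (Fin d) (Fin d) ℂ) : Matrix (Fin d) (Fin d) ℂ :=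
  CFC.sqrt (M.op i) * U.1 * ρ * star U.1 * CFC.sqrt (M.op i)

/-- The probability `tr(√Π_{iₙ} U ⋯ √Π_{i₁} U ρ U* √Π_{i₁} ⋯ U* √Π_{iₙ})` that the system, started
in the state `ρ`, generates the string of outcomes `ι = (i₁, …, iₙ)`. The trace is real. -/
noncomputable def stringProb (M : POVM d k) (U : Matrix.unitaryGroup (Fin d) ℂ)
    (ρ : Matrix (Fin d) (Fin d) ℂ) (ι : List (Fin k)) : ℝ :=
  (ι.foldl (fun σ i => M.evolve U i σ) ρ).trace.re

/-- The maximally mixed state `𝕀 / d`. -/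
noncomputable def maxMixed (d : ℕ) : Matrix (Fin d) (Fin d) ℂ := (d : ℂ)⁻¹ • 1

theorem evolve_posSemidef (M : POVM d k) (U : Matrix.unitaryGroup (Fin d) ℂ) (i : Fin k)
    {ρ : Matrix (Fin d) (Fin d) ℂ} (hρ : ρ.PosSemidef) : (M.evolve U i ρ).PosSemidef := by
  have hs : star (CFC.sqrt (M.op i)) = CFC.sqrt (M.op i) :=
    (CFC.sqrt_nonneg (M.op i)).isSelfAdjoint
  have h := hρ.mul_mul_conjTranspose_same (CFC.sqrt (M.op i) * U.1)
  rw [← Matrix.star_eq_conjTranspose, star_mul, hs] at h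
  simpa [evolve, mul_assoc] using h

theorem trace_evolve (M : POVM d k) (U : Matrix.unitaryGroup (Fin d) ℂ) (i : Fin k)
    (ρ : Matrix (Fin d) (Fin d) ℂ) :
    (M.evolve U i ρ).trace = (M.op i * (U.1 * ρ * star U.1)).trace := by
  have h : CFC.sqrt (M.op i) * CFC.sqrt (M.op i) = M.op i :=
    CFC.sqrt_mul_sqrt_self _ (M.posSemidef i).nonneg
  rw [evolve, Matrix.trace_mul_comm]
  simp only [← mul_assoc, h]

theorem sum_trace_evolve (M : POVM d k) (U : Matrix.unitaryGroup (Fin d) ℂ)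
    (ρ : Matrix (Fin d) (Fin d) ℂ) : ∑ i, (M.evolve U i ρ).trace = ρ.trace := by
  simp only [trace_evolve]
  rw [← Matrix.trace_sum, ← Finset.sum_mul, M.sum_eq_one, one_mul, Matrix.trace_mul_comm,
    ← mul_assoc, Unitary.coe_star_mul_self, one_mul]

theorem foldl_posSemidef (M : POVM d k) (U : Matrix.unitaryGroup (Fin d) ℂ) (ι : List (Fin k))
    {ρ : Matrix (Fin d) (Fin d) ℂ} (hρ : ρ.PosSemidef) :
    (ι.foldl (fun σ i => M.evolve U i σ) ρ).PosSemidef := by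
  induction ι generalizing ρ with
  | nil => exact hρ
  | cons i ι ih => exact ih (M.evolve_posSemidef U i hρ)

theorem maxMixed_posSemidef (d : ℕ) : (maxMixed d).PosSemidef :=
  Matrix.PosSemidef.one.smul (by positivity)

theorem stringProb_nonneg (M : POVM d k) (U : Matrix.unitaryGroup (Fin d) ℂ) (ι : List (Fin k)) :
    0 ≤ M.stringProb U (maxMixed d) ι :=
  (Complex.le_def.1 (M.foldl_posSemidef U ι (maxMixed_posSemidef d)).trace_nonneg).1

theorem sum_stringProb_append (M : POVM d k) (U : Matrix.unitaryGroup (Fin d) ℂ)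
    (ι : List (Fin k)) :
    ∑ a, M.stringProb U (maxMixed d) (ι ++ [a]) = M.stringProb U (maxMixed d) ι := by
  simp only [stringProb, List.foldl_append, List.foldl_cons, List.foldl_nil]
  rw [← Complex.re_sum, sum_trace_evolve]

theorem exists_outcomeMeasure [NeZero d] (M : POVM d k) (U : Matrix.unitaryGroup (Fin d) ℂ) :
    ∃ μ : Measure (ℕ → Fin k), IsProbabilityMeasure μ ∧
      ∀ ι, μ (cylinder ι) = ENNReal.ofReal (M.stringProb U (maxMixed d) ι) := by
  refine exists_measure_cylinder _ ?_ fun ι => ?_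
  · simp [stringProb, maxMixed, NeZero.ne d]
  · rw [← ENNReal.ofReal_sum_of_nonneg fun a _ => M.stringProb_nonneg U _, sum_stringProb_append]

/-- The measure `ℙ_*` on sequences of measurement outcomes: the probability measure that gives each
cylinder set the probability of its string, the initial state being maximally mixed. -/
noncomputable def outcomeMeasure [NeZero d] (M : POVM d k) (U : Matrix.unitaryGroup (Fin d) ℂ) :
    Measure (ℕ → Fin k) :=
  (M.exists_outcomeMeasure U).choose

instance [NeZero d] (M : POVM d k) (U : Matrix.unitaryGroup (Fin d) ℂ) :
    IsProbabilityMeasure (M.outcomeMeasure U) :=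
  (M.exists_outcomeMeasure U).choose_spec.1

theorem outcomeMeasure_cylinder [NeZero d] (M : POVM d k) (U : Matrix.unitaryGroup (Fin d) ℂ)
    (ι : List (Fin k)) :
    M.outcomeMeasure U (cylinder ι) = ENNReal.ofReal (M.stringProb U (maxMixed d) ι) :=
  (M.exists_outcomeMeasure U).choose_spec.2 ι

theorem eq_outcomeMeasure [NeZero d] (M : POVM d k) (U : Matrix.unitaryGroup (Fin d) ℂ)
    {μ : Measure (ℕ → Fin k)}
    (h : ∀ ι, μ (cylinder ι) = ENNReal.ofReal (M.stringProb U (maxMixed d) ι)) :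
    μ = M.outcomeMeasure U :=
  (measure_ext_cylinder fun ι => by rw [h, outcomeMeasure_cylinder]).symm

theorem sum_evolve_maxMixed (M : POVM d k) (U : Matrix.unitaryGroup (Fin d) ℂ) :
    ∑ i, M.evolve U i (maxMixed d) = maxMixed d := by
  have h (i : Fin k) : M.evolve U i (maxMixed d) = (d : ℂ)⁻¹ • M.op i := by
    have hs : CFC.sqrt (M.op i) * CFC.sqrt (M.op i) = M.op i :=
      CFC.sqrt_mul_sqrt_self _ (M.posSemidef i).nonneg
    have hU : U.1 * star U.1 = 1 := Unitary.coe_mul_star_self U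
    simp [evolve, maxMixed, mul_assoc, hU, hs]
  simp only [h]
  rw [← Finset.smul_sum, M.sum_eq_one, maxMixed]

theorem foldl_sum (M : POVM d k) (U : Matrix.unitaryGroup (Fin d) ℂ) (ι : List (Fin k))
    (f : Fin k → Matrix (Fin d) (Fin d) ℂ) :
    ι.foldl (fun σ i => M.evolve U i σ) (∑ j, f j) =
      ∑ j, ι.foldl (fun σ i => M.evolve U i σ) (f j) := by
  induction ι generalizing f with
  | nil => rfl
  | cons i ι ih =>
    have h : M.evolve U i (∑ j, f j) = ∑ j, M.evolve U i (f j) := by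
      simp [evolve, Finset.mul_sum, Finset.sum_mul]
    simp only [List.foldl_cons, h, ih]

theorem sum_stringProb_cons (M : POVM d k) (U : Matrix.unitaryGroup (Fin d) ℂ)
    (ι : List (Fin k)) :
    ∑ a, M.stringProb U (maxMixed d) (a :: ι) = M.stringProb U (maxMixed d) ι := by
  simp only [stringProb, List.foldl_cons]
  rw [← Complex.re_sum, ← Matrix.trace_sum, ← foldl_sum, sum_evolve_maxMixed]

/-- `ℙ_*` is shift-invariant. -/
theorem measurePreserving_shift [NeZero d] (M : POVM d k) (U : Matrix.unitaryGroup (Fin d) ℂ) :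
    MeasurePreserving shift (M.outcomeMeasure U) (M.outcomeMeasure U) := by
  have hm : Measurable (shift (α := Fin k)) :=
    measurable_pi_lambda _ fun n => measurable_pi_apply (n + 1)
  refine ⟨hm, M.eq_outcomeMeasure U fun ι => ?_⟩
  have hpre : shift ⁻¹' cylinder ι = ⋃ a : Fin k, cylinder (a :: ι) := by
    ext s
    simp only [Set.mem_preimage, Set.mem_iUnion, mem_cylinder]
    constructor
    · intro h
      refine ⟨s 0, fun i hi => ?_⟩
      cases i with
      | zero => rfl
      | succ i => exact h i (by simpa using hi)
    · rintro ⟨a, h⟩ i hi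
      exact h (i + 1) (by simpa using hi)
  rw [Measure.map_apply hm (measurableSet_cylinder ι), hpre,
    measure_iUnion (fun a b hab => ?_) (fun a => measurableSet_cylinder _), tsum_fintype]
  · simp only [outcomeMeasure_cylinder]
    rw [← ENNReal.ofReal_sum_of_nonneg fun a _ => M.stringProb_nonneg U _, sum_stringProb_cons]
  · exact (disjoint_cylinder [] ι hab).mono_left (cylinder_append_subset [a] ι) |>.mono_right le_rfl

end POVM

end RepeatedMeasurement

/-! The outcomes 1 and 2 are the symbols `0` and `1`; write `p` for `Π₂`, so `p x = ⟪z, x⟫ z`.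

The equivalence of (ii), (iii) and (iv) is linear algebra (`tfae_invtSubmodule_rankOne`). It rests
on two facts: `U` preserves orthogonal complements of its invariant subspaces, and a non-zero
invariant subspace contains an eigenvector.

Ergodicity enters because the rank one outcome `1` resets the state to `Π₂`, so the process
regenerates there and, given an occurrence of `1`, past and future are independent
(`stringProb_append_cons`). If no eigenvector of `U` lies in `Θ`, the compression `Π₁U` has only
eigenvalues of modulus below one (`hasEigenvector_of_compression`), its powers tend to zero, and an
endless run of `0` has probability zero. So from any time on a `1` almost surely occurs;
regeneration then makes every shift-invariant event independent of all cylinders, hence of itself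
(`ergodic_shift_of_regenerative`).

Conversely, an eigenvector in `Θ` is never shortened by `Π₁U`, so every run of `0` has probability
at least `1/d`, and the shift-invariant event "eventually `0`" has positive probability. It is not
almost sure: by shift invariance it agrees up to a null set with "always `0`", while the first
outcome is `1` with probability `1/d`. The same comparison of "eventually" with "always", together
with continuity from above along the cylinders of `0 ⋯ 0`, gives the limit formula. -/

/-! ### Isometries, rank one projections and compressions -/

section LinearAlgebra

open scoped InnerProductSpace

variable {E : Type*} [NormedAddCommGroup E] [InnerProductSpace ℂ E]

/-- An element of a complex Banach algebra whose spectrum lies in the open unit disc has powers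
tending to zero. -/
theorem tendsto_pow_atTop_nhds_zero_of_forall_spectrum_lt {A : Type*} [NormedRing A]
    [NormedAlgebra ℂ A] [CompleteSpace A] [Nontrivial A] (a : A)
    (h : ∀ k ∈ spectrum ℂ a, ‖k‖ < 1) : Tendsto (fun n : ℕ => a ^ n) atTop (𝓝 0) := by
  have hρ : spectralRadius ℂ a < ((1 : NNReal) : ℝ≥0∞) :=
    spectrum.spectralRadius_lt_of_forall_lt a fun k hk => by simpa [← NNReal.coe_lt_coe] using h k hk
  -- By Gelfand's formula the `n`-th root of `‖a ^ n‖` is eventually below `r`, so `r ^ n`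
  -- dominates.
  obtain ⟨r, har, hr1⟩ := ENNReal.lt_iff_exists_nnreal_btwn.1 hρ
  have hev := (spectrum.pow_nnnorm_pow_one_div_tendsto_nhds_spectralRadius a).eventually_lt_const har
  refine squeeze_zero_norm' (a := fun n => (r : ℝ) ^ n) ?_
    (tendsto_pow_atTop_nhds_zero_of_lt_one r.2 (by exact_mod_cast hr1))
  filter_upwards [hev, eventually_gt_atTop 0] with n hn hn0
  have hn0' : (0 : ℝ) < n := by exact_mod_cast hn0
  have h1 : (‖a ^ n‖₊ : ℝ≥0∞) ≤ (r : ℝ≥0∞) ^ (n : ℝ) := by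
    have := ENNReal.rpow_le_rpow hn.le hn0'.le
    rwa [← ENNReal.rpow_mul, one_div_mul_cancel hn0'.ne', ENNReal.rpow_one] at this
  rw [ENNReal.rpow_natCast] at h1
  exact_mod_cast h1

/-- A non-zero invariant subspace of a complex operator contains an eigenvector. -/
theorem Module.End.exists_hasEigenvector_mem_of_mem_invtSubmodule {V : Type*} [AddCommGroup V]
    [Module ℂ V] [FiniteDimensional ℂ V] {f : Module.End ℂ V} {W : Submodule ℂ V} (hW : W ≠ ⊥)
    (hf : W ∈ Module.End.invtSubmodule f) : ∃ v ∈ W, ∃ μ : ℂ, Module.End.HasEigenvector f μ v := by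
  have : Nontrivial W := Submodule.nontrivial_iff_ne_bot.2 hW
  obtain ⟨μ, hμ⟩ := Module.End.exists_eigenvalue (f.restrict hf)
  obtain ⟨v, hv⟩ := hμ.exists_hasEigenvector
  refine ⟨v, v.2, μ, Module.End.hasEigenvector_iff.2 ⟨Module.End.mem_eigenspace_iff.2 ?_, ?_⟩⟩
  · exact congrArg Subtype.val hv.apply_eq_smul
  · simpa using hv.2

variable {u p : E →ₗ[ℂ] E} {z : E}

/-- The orthogonal complement of an invariant subspace of a linear isometry is invariant. -/
theorem orthogonal_mem_invtSubmodule_of_inner_map_map [FiniteDimensional ℂ E]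
    (hu : ∀ x y, ⟪u x, u y⟫_ℂ = ⟪x, y⟫_ℂ) {W : Submodule ℂ E}
    (hW : W ∈ Module.End.invtSubmodule u) : Wᗮ ∈ Module.End.invtSubmodule u := by
  have hinj : Function.Injective (LinearMap.restrict u hW) := by
    rw [← LinearMap.ker_eq_bot, LinearMap.ker_eq_bot']
    intro x hx
    have h0 : u x = 0 := congrArg Subtype.val hx
    have := hu x x
    rw [h0, inner_zero_left] at this
    exact Subtype.ext (inner_self_eq_zero.1 this.symm)
  -- Finite dimension makes `u` map `W` onto itself, so every `x ∈ W` is some `u y` with `y ∈ W`,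
  -- and `⟪u y, u w⟫ = ⟪y, w⟫ = 0`.
  have hsurj := LinearMap.injective_iff_surjective.1 hinj
  intro w hw
  rw [Submodule.mem_comap, Submodule.mem_orthogonal]
  intro x hx
  obtain ⟨y, hy⟩ := hsurj ⟨x, hx⟩
  have hy' : u y = x := congrArg Subtype.val hy
  rw [← hy', hu]
  exact (Submodule.mem_orthogonal W w).1 hw y y.2

theorem norm_eigenvalue_of_inner_map_map (hu : ∀ x y, ⟪u x, u y⟫_ℂ = ⟪x, y⟫_ℂ) {μ : ℂ} {v : E}
    (hv : Module.End.HasEigenvector u μ v) : ‖μ‖ = 1 := by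
  have h1 : ‖u v‖ = ‖v‖ := by
    rw [@norm_eq_sqrt_re_inner ℂ, @norm_eq_sqrt_re_inner ℂ _ _ _ _ v, hu]
  rw [hv.apply_eq_smul, norm_smul] at h1
  exact mul_right_cancel₀ (norm_ne_zero_iff.2 hv.2) (by rw [h1, one_mul])

/-- A symmetric idempotent whose range is spanned by a unit vector is the corresponding rank one
projection. -/
theorem LinearMap.IsSymmetric.apply_eq_inner_smul (hp : p.IsSymmetric) (hpp : ∀ x, p (p x) = p x)
    (hz : ‖z‖ = 1) (hspan : LinearMap.range p = Submodule.span ℂ {z}) (x : E) :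
    p x = ⟪z, x⟫_ℂ • z := by
  have hpz : p z = z := by
    have : z ∈ LinearMap.range p := hspan ▸ Submodule.mem_span_singleton_self z
    obtain ⟨y, rfl⟩ := this
    exact hpp y
  have : p x ∈ Submodule.span ℂ {z} := hspan ▸ LinearMap.mem_range_self p x
  obtain ⟨c, hc⟩ := Submodule.mem_span_singleton.1 this
  have h1 : ⟪z, p x⟫_ℂ = ⟪z, x⟫_ℂ := by rw [← hp z x, hpz]
  rw [← hc, inner_smul_right, inner_self_eq_norm_sq_to_K, hz] at h1
  rw [← hc, ← h1]
  simp

/-- For an isometry `u` and the rank one projection `p` onto the line of `z`, having a non-trivial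
common invariant subspace, `z` lying in a non-trivial `u`-invariant subspace, and having an
eigenvector of `u` orthogonal to `z` are equivalent. -/
theorem tfae_invtSubmodule_rankOne [FiniteDimensional ℂ E]
    (hu : ∀ x y, ⟪u x, u y⟫_ℂ = ⟪x, y⟫_ℂ) (hz : z ≠ 0) (hp : ∀ x, p x = ⟪z, x⟫_ℂ • z) :
    List.TFAE [
      ∃ W : Submodule ℂ E, W ≠ ⊥ ∧ W ≠ ⊤ ∧
        W ∈ Module.End.invtSubmodule u ∧ W ∈ Module.End.invtSubmodule p,
      ∃ W : Submodule ℂ E, W ≠ ⊥ ∧ W ≠ ⊤ ∧ W ∈ Module.End.invtSubmodule u ∧ z ∈ W,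
      ∃ v ∈ (Submodule.span ℂ {z})ᗮ, ∃ μ : ℂ, Module.End.HasEigenvector u μ v] := by
  tfae_have 1 → 3 := by
    rintro ⟨W, hbot, htop, hWu, hWp⟩
    -- If `z ∈ W`, the eigenvector is sought in `Wᗮ`. Otherwise `W` itself is orthogonal to `z`: for
    -- `v ∈ W` the vector `⟪z, v⟫ z` is in `W`, which forces the coefficient to vanish.
    by_cases hzW : z ∈ W
    · obtain ⟨v, hv, h⟩ := Module.End.exists_hasEigenvector_mem_of_mem_invtSubmodule (W := Wᗮ)
        (by rwa [Ne, Submodule.orthogonal_eq_bot_iff])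
        (orthogonal_mem_invtSubmodule_of_inner_map_map hu hWu)
      exact ⟨v, Submodule.orthogonal_le ((Submodule.span_singleton_le_iff_mem z W).2 hzW) hv, h⟩
    · obtain ⟨v, hv, h⟩ := Module.End.exists_hasEigenvector_mem_of_mem_invtSubmodule hbot hWu
      refine ⟨v, Submodule.mem_orthogonal_singleton_iff_inner_right.2 ?_, h⟩
      by_contra hne
      refine hzW ((W.smul_mem_iff hne).1 ?_)
      rw [← hp]
      exact hWp hv
  tfae_have 3 → 2 := by
    rintro ⟨v, hvz, μ, hv⟩
    have hzv : z ∈ (Submodule.span ℂ {v})ᗮ :=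
      Submodule.mem_orthogonal_singleton_iff_inner_left.2
        (Submodule.mem_orthogonal_singleton_iff_inner_right.1 hvz)
    -- The hyperplane orthogonal to the eigenvector contains `z` and omits `v`.
    refine ⟨(Submodule.span ℂ {v})ᗮ, ?_, ?_,
      orthogonal_mem_invtSubmodule_of_inner_map_map hu ?_, hzv⟩
    · exact fun h => hz (by simpa [h] using hzv)
    · intro h
      have hvv : v ∈ (Submodule.span ℂ {v})ᗮ := h ▸ Submodule.mem_top
      exact hv.2 (inner_self_eq_zero.1 (Submodule.mem_orthogonal_singleton_iff_inner_right.1 hvv))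
    · rw [Module.End.mem_invtSubmodule, Submodule.span_singleton_le_iff_mem, Submodule.mem_comap,
        hv.apply_eq_smul]
      exact Submodule.smul_mem _ _ (Submodule.mem_span_singleton_self v)
  tfae_have 2 → 1 := by
    rintro ⟨W, hbot, htop, hWu, hzW⟩
    exact ⟨W, hbot, htop, hWu, fun x _ => by
      rw [Submodule.mem_comap, hp]; exact W.smul_mem _ hzW⟩
  tfae_finish

/-- An eigenvalue of modulus at least one of the compression of an isometry `u` to the orthogonal
complement of `z` comes from an eigenvector of `u`. -/
theorem hasEigenvector_of_compression (hu : ∀ x y, ⟪u x, u y⟫_ℂ = ⟪x, y⟫_ℂ) (hz : ‖z‖ = 1)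
    {μ : ℂ} {v : E} (hv : v ≠ 0) (hμ : 1 ≤ ‖μ‖) (h : u v - ⟪z, u v⟫_ℂ • z = μ • v) :
    v ∈ (Submodule.span ℂ {z})ᗮ ∧ Module.End.HasEigenvector u μ v := by
  have hn : ‖u v‖ = ‖v‖ := by
    rw [@norm_eq_sqrt_re_inner ℂ, @norm_eq_sqrt_re_inner ℂ _ _ _ _ v, hu]
  have hzz : ⟪z, z⟫_ℂ = 1 := by rw [inner_self_eq_norm_sq_to_K, hz]; simp
  have horth : ⟪z, μ • v⟫_ℂ = 0 := by
    rw [← h, inner_sub_right, inner_smul_right, hzz, mul_one, sub_self]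
  -- The compressed vector `μ v` is orthogonal to `z`, so `‖v‖² = ‖μ‖² ‖v‖² + ‖⟪z, u v⟫‖²`; with
  -- `‖μ‖ ≥ 1` the last term must vanish.
  have hpyth : ‖u v‖ * ‖u v‖ = ‖μ • v‖ * ‖μ • v‖ + ‖⟪z, u v⟫_ℂ • z‖ * ‖⟪z, u v⟫_ℂ • z‖ := by
    rw [← norm_add_sq_eq_norm_sq_add_norm_sq_of_inner_eq_zero (𝕜 := ℂ), ← h, sub_add_cancel]
    rw [inner_smul_right, ← inner_conj_symm (μ • v), horth, map_zero, mul_zero]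
  rw [hn, norm_smul, norm_smul, hz, mul_one] at hpyth
  have hle : ‖v‖ ≤ ‖μ‖ * ‖v‖ := le_mul_of_one_le_left (norm_nonneg v) hμ
  have h0 : ⟪z, u v⟫_ℂ = 0 := by
    rw [← norm_eq_zero]
    nlinarith [norm_nonneg v, norm_nonneg ⟪z, u v⟫_ℂ, mul_self_nonneg ‖⟪z, u v⟫_ℂ‖]
  have hμ0 : μ ≠ 0 := norm_pos_iff.1 (by linarith)
  rw [h0, zero_smul, sub_zero] at h
  refine ⟨Submodule.mem_orthogonal_singleton_iff_inner_right.2 ?_,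
    Module.End.hasEigenvector_iff.2 ⟨Module.End.mem_eigenspace_iff.2 h, hv⟩⟩
  rw [inner_smul_right] at horth
  exact (mul_eq_zero.1 horth).resolve_left hμ0

end LinearAlgebra

/-! ### Regenerative measures on sequences and ergodicity -/

namespace RepeatedMeasurement

section Sequences

variable {α : Type*}

theorem shift_iterate_apply (n : ℕ) (s : ℕ → α) (i : ℕ) : shift^[n] s i = s (i + n) := by
  induction n generalizing i with
  | zero => rfl
  | succ n ih => rw [Function.iterate_succ_apply', shift, ih]; congr 1; omega

theorem cylinder_nil : cylinder ([] : List α) = Set.univ := by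
  ext s; simp [mem_cylinder]

theorem mem_cylinder_append {ι κ : List α} {s : ℕ → α} :
    s ∈ cylinder (ι ++ κ) ↔ s ∈ cylinder ι ∧ shift^[ι.length] s ∈ cylinder κ := by
  simp only [mem_cylinder, shift_iterate_apply]
  constructor
  · refine fun h => ⟨fun i hi => ?_, fun i hi => ?_⟩
    · rw [h i (by simp; omega), List.getElem_append_left]
    · rw [h (i + ι.length) (by simp; omega), List.getElem_append_right (by omega)]
      simp
  · rintro ⟨h1, h2⟩ i hi
    rcases lt_or_ge i ι.length with h | h
    · rw [h1 i h, List.getElem_append_left]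
    · have := h2 (i - ι.length) (by simp at hi; omega)
      rw [List.getElem_append_right h, ← this, Nat.sub_add_cancel h]

theorem mem_cylinder_singleton {a : α} {s : ℕ → α} : s ∈ cylinder [a] ↔ s 0 = a := by
  simp [mem_cylinder]

theorem mem_cylinder_replicate {a : α} {m : ℕ} {s : ℕ → α} :
    s ∈ cylinder (List.replicate m a) ↔ ∀ i < m, s i = a := by
  simp [mem_cylinder]

variable [MeasurableSpace α] [MeasurableSingletonClass α]

theorem measurableSet_forall_eq (a : α) : MeasurableSet {s : ℕ → α | ∀ n, s n = a} := by
  rw [Set.ofPred_forall]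
  exact MeasurableSet.iInter fun n => (measurableSet_singleton a).preimage (measurable_pi_apply n)

theorem tendsto_measure_cylinder_replicate (μ : Measure (ℕ → α)) [IsFiniteMeasure μ] (a : α) :
    Tendsto (fun m => μ (cylinder (List.replicate m a))) atTop (𝓝 (μ {s | ∀ n, s n = a})) := by
  have h : {s : ℕ → α | ∀ n, s n = a} = ⋂ m, cylinder (List.replicate m a) := by
    ext s
    simp only [Set.mem_ofPred_eq, Set.mem_iInter, mem_cylinder_replicate]
    exact ⟨fun h m i _ => h i, fun h n => h (n + 1) n (by omega)⟩
  rw [h]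
  refine tendsto_measure_iInter_atTop (fun m => (measurableSet_cylinder _).nullMeasurableSet)
    (fun m n hmn s hs => ?_) ⟨0, measure_ne_top _ _⟩
  rw [mem_cylinder_replicate] at hs ⊢
  exact fun i hi => hs i (by omega)

/-- For a shift-invariant measure, a sequence that is eventually constant `a` is almost surely
constant `a` from the start. -/
theorem measure_eventually_eq {μ : Measure (ℕ → α)} (hμ : MeasurePreserving shift μ μ)
    (a : α) : μ {s | ∀ᶠ n in atTop, s n = a} = μ {s | ∀ n, s n = a} := by
  have h : {s : ℕ → α | ∀ᶠ n in atTop, s n = a} = ⋃ m, shift^[m] ⁻¹' {s | ∀ n, s n = a} := by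
    ext s
    simp only [Set.mem_ofPred_eq, Set.mem_iUnion, Set.mem_preimage, shift_iterate_apply,
      eventually_atTop]
    exact exists_congr fun m => ⟨fun h n => h _ (by omega), fun h n hn => by
      simpa [Nat.sub_add_cancel hn] using h (n - m)⟩
  -- The preimages increase with `m` and all have the same measure, so their union has that measure
  -- too.
  have hmono : Monotone fun m => shift^[m] ⁻¹' {s : ℕ → α | ∀ n, s n = a} := by
    intro m n hmn s hs i
    have := hs (i + n - m)
    rw [shift_iterate_apply] at this ⊢
    rwa [Nat.sub_add_cancel (by omega)] at this
  rw [h, hmono.measure_iUnion]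
  simp only [fun m => (hμ.iterate m).measure_preimage (measurableSet_forall_eq a).nullMeasurableSet, ciSup_const]

/-- If the past and the future are independent given an occurrence of `b`, then so are the past
and every shift-invariant event. -/
theorem measure_cylinder_append_inter_of_preimage_eq [Finite α] {μ : Measure (ℕ → α)} [IsFiniteMeasure μ]
    {b : α} (hreg : ∀ ι κ, μ (cylinder (ι ++ b :: κ)) * μ (cylinder [b]) =
      μ (cylinder (ι ++ [b])) * μ (cylinder (b :: κ)))
    {s : Set (ℕ → α)} (hs : MeasurableSet s) (hinv : shift ⁻¹' s = s) (ι : List α) :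
    μ (cylinder [b]) * μ (s ∩ cylinder (ι ++ [b])) =
      μ (cylinder (ι ++ [b])) * μ (s ∩ cylinder [b]) := by
  have hm : Measurable (shift (α := α)) :=
    measurable_pi_lambda _ fun n => measurable_pi_apply (n + 1)
  have hinv' (n : ℕ) : shift^[n] ⁻¹' s = s := by
    induction n with
    | zero => rfl
    | succ n ih => rw [Function.iterate_succ, Set.preimage_comp, ih, hinv]
  have happ (ι κ : List α) : (μ.restrict (cylinder ι)).map shift^[ι.length] (cylinder κ) =
      μ (cylinder (ι ++ κ)) := by
    rw [Measure.map_apply (hm.iterate _) (measurableSet_cylinder κ),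
      Measure.restrict_apply (hm.iterate _ (measurableSet_cylinder κ))]
    congr 1
    ext t
    rw [mem_cylinder_append, and_comm]
    rfl
  have hfin : IsFiniteMeasure
      (μ (cylinder [b]) • (μ.restrict (cylinder (ι ++ [b]))).map shift^[(ι ++ [b]).length]) :=
    Measure.smul_finite _ (measure_ne_top _ _)
  -- These are the laws of the future after `ι ++ [b]` and after `[b]`, unnormalised. `hreg` is
  -- their equality on cylinders; evaluation at the invariant set `s`, which equals its own
  -- preimages, gives the claim.
  have key : μ (cylinder [b]) • (μ.restrict (cylinder (ι ++ [b]))).map shift^[(ι ++ [b]).length] =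
      μ (cylinder (ι ++ [b])) • (μ.restrict (cylinder [b])).map shift^[[b].length] := by
    refine measure_ext_cylinder fun κ => ?_
    rw [Measure.smul_apply, Measure.smul_apply, happ, happ, smul_eq_mul, smul_eq_mul,
      List.append_assoc, List.singleton_append, mul_comm]
    exact hreg ι κ
  have := congrArg (fun ν => ν s) key
  simpa only [Measure.smul_apply, smul_eq_mul, Measure.map_apply (hm.iterate _) hs, hinv',
    Measure.restrict_apply hs] using this

end Sequences

/-- A shift-invariant probability measure on binary sequences that regenerates at the symbol `1`,
and for which `1` occurs almost surely, is ergodic. -/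
theorem ergodic_shift_of_regenerative {μ : Measure (ℕ → Fin 2)} [IsProbabilityMeasure μ]
    (hμ : MeasurePreserving shift μ μ) (hpos : μ (cylinder [1]) ≠ 0)
    (hreg : ∀ ι κ, μ (cylinder (ι ++ 1 :: κ)) * μ (cylinder [1]) =
      μ (cylinder (ι ++ [1])) * μ (cylinder (1 :: κ)))
    (hzero : μ {s | ∀ n, s n = 0} = 0) : Ergodic shift μ := by
  refine ⟨hμ, ⟨fun s hs hinv => ?_⟩⟩
  -- The conditional probability of `s` given an initial `1`; by regeneration it is the same after
  -- any string that ends in `1`.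
  set c : ℝ≥0∞ := μ (s ∩ cylinder [1]) * (μ (cylinder [1]))⁻¹ with hc
  have hmark (ι : List (Fin 2)) :
      μ (s ∩ cylinder (ι ++ [1])) = c * μ (cylinder (ι ++ [1])) := by
    have h := measure_cylinder_append_inter_of_preimage_eq hreg hs hinv ι
    calc μ (s ∩ cylinder (ι ++ [1]))
        = (μ (cylinder [1]))⁻¹ * (μ (cylinder [1]) * μ (s ∩ cylinder (ι ++ [1]))) := by
          rw [← mul_assoc, ENNReal.inv_mul_cancel hpos (measure_ne_top _ _), one_mul]
      _ = c * μ (cylinder (ι ++ [1])) := by rw [h, hc]; ring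
  have hcyl (ι : List (Fin 2)) : μ (s ∩ cylinder ι) = c * μ (cylinder ι) := by
    -- Up to a null set, `cylinder ι` is partitioned by the waiting time `m` for the first `1` after
    -- `ι`.
    let C (m : ℕ) : Set (ℕ → Fin 2) := cylinder ((ι ++ List.replicate m 0) ++ [1])
    have hCm (m : ℕ) : MeasurableSet (C m) := measurableSet_cylinder _
    have hdisj : Pairwise (Function.onFun Disjoint C) := by
      refine (pairwise_disjoint_on C).2 fun m n hmn => ?_
      have hn : List.replicate n (0 : Fin 2) =
          List.replicate m 0 ++ 0 :: List.replicate (n - m - 1) 0 := by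
        rw [← List.replicate_succ, List.replicate_append_replicate]
        congr 1; omega
      have : C n = cylinder ((ι ++ List.replicate m 0) ++
          (0 :: (List.replicate (n - m - 1) 0 ++ [1]))) := by
        simp only [C, hn, List.append_assoc, List.cons_append]
      rw [this]
      exact disjoint_cylinder _ _ (by decide)
    have hsub : (⋃ m, C m) ⊆ cylinder ι := Set.iUnion_subset fun m => by
      simp only [C, List.append_assoc]
      exact cylinder_append_subset _ _
    have hnull : μ (cylinder ι \ ⋃ m, C m) = 0 := by
      refine measure_mono_null (t := shift^[ι.length] ⁻¹' {s | ∀ n, s n = 0}) ?_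
        (((hμ.iterate _).measure_preimage (measurableSet_forall_eq 0).nullMeasurableSet).trans hzero)
      -- A sequence that lies in no `C m` continues `ι` with zeros only: a first non-zero entry at
      -- position `n` would put it in `C n`.
      rintro t ⟨htι, ht⟩ n
      induction n using Nat.strong_induction_on with
      | _ n ih =>
        by_contra hne
        refine ht (Set.mem_iUnion.2 ⟨n, ?_⟩)
        rw [mem_cylinder_append, mem_cylinder_append, mem_cylinder_replicate,
          mem_cylinder_singleton]
        refine ⟨⟨htι, ih⟩, ?_⟩
        rw [shift_iterate_apply] at hne ⊢
        have : 0 + (ι ++ List.replicate n (0 : Fin 2)).length = n + ι.length := by simp; omega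
        rw [this]
        exact Fin.eq_one_of_ne_zero _ hne
    have hae : (⋃ m, C m) =ᵐ[μ] cylinder ι :=
      hsub.eventuallyLE.antisymm (ae_le_set.2 hnull)
    rw [← measure_congr hae, ← measure_congr ((ae_eq_refl s).inter hae), Set.inter_iUnion,
      measure_iUnion hdisj hCm, measure_iUnion
        (fun m n hmn => (hdisj hmn).mono Set.inter_subset_right Set.inter_subset_right)
        (fun m => hs.inter (hCm m)), ← ENNReal.tsum_mul_left]
    exact tsum_congr fun m => hmark _
  -- Conditioning on `s` thus only rescales `μ`. The whole space gives `c = μ s`, and `s` itself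
  -- gives `μ s = μ s * μ s`.
  have hrestrict : μ.restrict s = c • μ := by
    refine measure_ext_cylinder fun ι => ?_
    rw [Measure.restrict_apply (measurableSet_cylinder ι), Set.inter_comm, hcyl,
      Measure.smul_apply, smul_eq_mul]
  have h1 : μ s = c := by simpa using congrArg (fun ν => ν Set.univ) hrestrict
  have h2 : μ s = μ s * μ s := by simpa [h1] using congrArg (fun ν => ν s) hrestrict
  rw [eventuallyConst_set]
  by_cases h0 : μ s = 0
  · exact Or.inr (measure_eq_zero_iff_ae_notMem.1 h0)
  · refine Or.inl ((prob_compl_eq_zero_iff hs).2 ?_)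
    exact ((ENNReal.mul_eq_left h0 (measure_ne_top μ s)).1 h2.symm)

end RepeatedMeasurement

/-! ### Norm estimates and powers of matrices -/

section Matrix

open scoped InnerProductSpace Matrix

variable {n : Type*} [Fintype n] [DecidableEq n]

theorem Matrix.toEuclideanLin_mul_apply (A B : Matrix n n ℂ) (x : EuclideanSpace ℂ n) :
    Matrix.toEuclideanLin (A * B) x = Matrix.toEuclideanLin A (Matrix.toEuclideanLin B x) := by
  simp [Matrix.toLpLin_apply, Matrix.mulVec_mulVec]

theorem Matrix.inner_toEuclideanLin_unitary (U : Matrix.unitaryGroup n ℂ)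
    (x y : EuclideanSpace ℂ n) :
    ⟪Matrix.toEuclideanLin U.1 x, Matrix.toEuclideanLin U.1 y⟫_ℂ = ⟪x, y⟫_ℂ := by
  rw [← LinearMap.adjoint_inner_right, ← Matrix.toEuclideanLin_conjTranspose_eq_adjoint,
    ← Matrix.toEuclideanLin_mul_apply, ← Matrix.star_eq_conjTranspose, Unitary.coe_star_mul_self]
  simp

/-- The operator norm is at most the Hilbert–Schmidt norm. -/
theorem Matrix.norm_sq_toEuclideanLin_le (B : Matrix n n ℂ) (x : EuclideanSpace ℂ n) :
    ‖Matrix.toEuclideanLin B x‖ ^ 2 ≤ (B * Bᴴ).trace.re * ‖x‖ ^ 2 := by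
  -- Row by row: an entry of `B x` is the inner product of a conjugated row with `x`, bounded by
  -- Cauchy–Schwarz, and the squared row norms are the diagonal of `B * Bᴴ`.
  have hrow (i : n) : ‖(WithLp.toLp 2 (star (B i)) : EuclideanSpace ℂ n)‖ ^ 2 =
      ((B * Bᴴ) i i).re := by
    rw [EuclideanSpace.norm_sq_eq, Matrix.mul_apply, Complex.re_sum]
    refine Finset.sum_congr rfl fun j _ => ?_
    simp [Matrix.conjTranspose_apply, Complex.mul_conj, Complex.normSq_eq_norm_sq,
      -Complex.ofReal_pow]
  rw [EuclideanSpace.norm_sq_eq, Matrix.trace, Complex.re_sum, Finset.sum_mul]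
  refine Finset.sum_le_sum fun i _ => ?_
  have hinner : (Matrix.toEuclideanLin B x) i =
      ⟪(WithLp.toLp 2 (star (B i)) : EuclideanSpace ℂ n), x⟫_ℂ := by
    simp [Matrix.toLpLin_apply, Matrix.mulVec, dotProduct, PiLp.inner_apply, mul_comm]
  rw [hinner, Matrix.diag_apply, ← hrow, ← mul_pow]
  exact pow_le_pow_left₀ (norm_nonneg _) (norm_inner_le_norm _ _) 2

open scoped Matrix.Norms.L2Operator in
/-- A matrix all of whose eigenvalues have modulus less than one has powers tending to zero. -/
theorem Matrix.tendsto_pow_atTop_nhds_zero [Nonempty n] (A : Matrix n n ℂ)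
    (h : ∀ (μ : ℂ) (v : EuclideanSpace ℂ n),
      Module.End.HasEigenvector (Matrix.toEuclideanLin A) μ v → ‖μ‖ < 1) :
    Tendsto (fun m : ℕ => A ^ m) atTop (𝓝 0) := by
  refine tendsto_pow_atTop_nhds_zero_of_forall_spectrum_lt A fun μ hμ => ?_
  rw [← Matrix.spectrum_toLpLin 2] at hμ
  obtain ⟨v, hv⟩ := (Module.End.hasEigenvalue_iff_mem_spectrum.2 hμ).exists_hasEigenvector
  exact h μ v hv

end Matrix

/-! ### String probabilities of projective measurements -/

namespace RepeatedMeasurement.POVM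

section PVM

variable {d k : ℕ} {M : POVM d k}

theorem IsPVM.sqrt_op (hM : M.IsPVM) (i : Fin k) : CFC.sqrt (M.op i) = M.op i :=
  CFC.sqrt_unique (hM i) (M.posSemidef i).nonneg

theorem IsPVM.evolve_eq (hM : M.IsPVM) (U : Matrix.unitaryGroup (Fin d) ℂ) (i : Fin k)
    (ρ : Matrix (Fin d) (Fin d) ℂ) :
    M.evolve U i ρ = (M.op i * U.1) * ρ * star (M.op i * U.1) := by
  have hs : star (M.op i) = M.op i := (M.posSemidef i).isHermitian
  rw [evolve, hM.sqrt_op, star_mul, hs, ← mul_assoc]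

theorem IsPVM.evolve_maxMixed (hM : M.IsPVM) (U : Matrix.unitaryGroup (Fin d) ℂ) (i : Fin k) :
    M.evolve U i (maxMixed d) = (d : ℂ)⁻¹ • M.op i := by
  have hs : star (M.op i) = M.op i := (M.posSemidef i).isHermitian
  have hU : U.1 * star U.1 = 1 := Unitary.coe_mul_star_self U
  rw [hM.evolve_eq, maxMixed, mul_smul_comm, mul_one, smul_mul_assoc, star_mul, mul_assoc,
    ← mul_assoc U.1, hU, one_mul, hs, (hM i).eq]

theorem IsPVM.stringProb_replicate (hM : M.IsPVM) (U : Matrix.unitaryGroup (Fin d) ℂ) (i : Fin k)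
    (m : ℕ) : (M.stringProb U (maxMixed d) (List.replicate m i) : ℂ) =
      (d : ℂ)⁻¹ * ((M.op i * U.1) ^ m * star (M.op i * U.1) ^ m).trace := by
  have hfold : (List.replicate m i).foldl (fun σ i => M.evolve U i σ) (maxMixed d) =
      (d : ℂ)⁻¹ • ((M.op i * U.1) ^ m * star (M.op i * U.1) ^ m) := by
    induction m with
    | zero => simp [maxMixed]
    | succ m ih =>
      rw [List.replicate_succ', List.foldl_append, ih, List.foldl_cons, List.foldl_nil,
        hM.evolve_eq, pow_succ', pow_succ]
      simp only [mul_smul_comm, smul_mul_assoc, mul_assoc]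
  -- A non-negative complex trace is real, so nothing is lost by taking its real part in
  -- `stringProb`.
  have hnn := (M.foldl_posSemidef U (List.replicate m i) (maxMixed_posSemidef d)).trace_nonneg
  rw [stringProb, ← Complex.eq_re_of_ofReal_le (r := 0) (by simpa using hnn), hfold,
    Matrix.trace_smul, smul_eq_mul]

theorem foldl_evolve_smul (M : POVM d k) (U : Matrix.unitaryGroup (Fin d) ℂ) (ι : List (Fin k))
    (c : ℂ) (ρ : Matrix (Fin d) (Fin d) ℂ) :
    ι.foldl (fun σ i => M.evolve U i σ) (c • ρ) =
      c • ι.foldl (fun σ i => M.evolve U i σ) ρ := by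
  induction ι generalizing ρ with
  | nil => rfl
  | cons i ι ih =>
    have h : M.evolve U i (c • ρ) = c • M.evolve U i ρ := by simp [evolve]
    simp only [List.foldl_cons, h, ih]

/-- After an outcome whose projection has rank one, the state is independent of the past. -/
theorem IsPVM.stringProb_append_cons (hM : M.IsPVM) (U : Matrix.unitaryGroup (Fin d) ℂ) {b : Fin k}
    {z : Fin d → ℂ} (hb : M.op b = Matrix.vecMulVec z (star z)) (htr : (M.op b).trace = 1)
    (ι κ : List (Fin k)) :
    M.stringProb U (maxMixed d) (ι ++ b :: κ) * M.stringProb U (maxMixed d) [b] =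
      M.stringProb U (maxMixed d) (ι ++ [b]) * M.stringProb U (maxMixed d) (b :: κ) := by
  set σ := ι.foldl (fun σ i => M.evolve U i σ) (maxMixed d) with hσ
  have hpsd : σ.PosSemidef := M.foldl_posSemidef U ι (maxMixed_posSemidef d)
  -- Sandwiching any matrix between two copies of a rank one projection leaves a scalar multiple of
  -- that projection; since the projection has trace one, the scalar is the trace.
  have hreset : M.evolve U b σ = (M.evolve U b σ).trace • M.op b := by
    obtain ⟨t, ht⟩ : ∃ t : ℂ, M.evolve U b σ = t • M.op b := by
      refine ⟨dotProduct (star z) (Matrix.mulVec (U.1 * σ * star U.1) z), ?_⟩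
      rw [evolve, hM.sqrt_op, hb, mul_assoc (Matrix.vecMulVec _ _) U.1 σ,
        mul_assoc (Matrix.vecMulVec _ _) (U.1 * σ), mul_assoc, Matrix.mul_vecMulVec,
        Matrix.vecMulVec_mul_vecMulVec]
      ext i j
      simp [Matrix.vecMulVec_apply, mul_left_comm]
    rw [ht, Matrix.trace_smul, htr, smul_eq_mul, mul_one]
  -- The scalar is real, so it can be pulled out of the real part in `stringProb`.
  have him : (M.evolve U b σ).trace = ((M.evolve U b σ).trace.re : ℂ) :=
    Complex.eq_re_of_ofReal_le (r := 0) (by simpa using (M.evolve_posSemidef U b hpsd).trace_nonneg)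
  simp only [stringProb, List.foldl_append, List.foldl_cons, List.foldl_nil, ← hσ]
  rw [hreset, hM.evolve_maxMixed, foldl_evolve_smul, foldl_evolve_smul, him]
  have hd : (d : ℂ)⁻¹ = (((d : ℝ)⁻¹ : ℝ) : ℂ) := by push_cast; rfl
  rw [hd]
  simp only [Matrix.trace_smul, htr, smul_eq_mul, mul_one, Complex.re_ofReal_mul,
    Complex.ofReal_re]
  ring

end PVM

end RepeatedMeasurement.POVM

/-! ### Ergodicity in terms of eigenvectors orthogonal to `z` -/

namespace RepeatedMeasurement.POVM

open scoped InnerProductSpace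

variable {d : ℕ} {M : POVM d 2} {z : EuclideanSpace ℂ (Fin d)}

theorem toEuclideanLin_op_zero (M : POVM d 2) (x : EuclideanSpace ℂ (Fin d)) :
    Matrix.toEuclideanLin (M.op 0) x = x - Matrix.toEuclideanLin (M.op 1) x := by
  have h : M.op 0 = 1 - M.op 1 := by
    rw [eq_sub_iff_add_eq, ← M.sum_eq_one, Fin.sum_univ_two]
  rw [h, map_sub, LinearMap.sub_apply]
  simp

/-- If the first outcome's projection is the complement of a rank one projection onto the line of
`z`, then it is the projection onto the orthogonal complement of `z`. -/
theorem range_op_zero (hz : ‖z‖ = 1)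
    (h1 : ∀ x, Matrix.toEuclideanLin (M.op 1) x = ⟪z, x⟫_ℂ • z) :
    LinearMap.range (Matrix.toEuclideanLin (M.op 0)) = (Submodule.span ℂ {z})ᗮ := by
  ext x
  rw [Submodule.mem_orthogonal_singleton_iff_inner_right, LinearMap.mem_range]
  constructor
  · rintro ⟨y, rfl⟩
    rw [toEuclideanLin_op_zero, h1, inner_sub_right, inner_smul_right,
      inner_self_eq_norm_sq_to_K, hz]
    simp
  · intro hx
    exact ⟨x, by rw [toEuclideanLin_op_zero, h1, hx, zero_smul, sub_zero]⟩

theorem op_one_eq_vecMulVec (h1 : ∀ x, Matrix.toEuclideanLin (M.op 1) x = ⟪z, x⟫_ℂ • z) :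
    M.op 1 = Matrix.vecMulVec z.ofLp (star z.ofLp) := by
  refine Matrix.toEuclideanLin.injective (LinearMap.ext fun x => ?_)
  rw [h1]
  ext i
  simp [Matrix.toLpLin_apply, Matrix.vecMulVec_mulVec, PiLp.inner_apply, dotProduct, mul_comm]

theorem trace_op_one (hz : ‖z‖ = 1)
    (h1 : ∀ x, Matrix.toEuclideanLin (M.op 1) x = ⟪z, x⟫_ℂ • z) : (M.op 1).trace = 1 := by
  have h : ⟪z, z⟫_ℂ = 1 := by rw [inner_self_eq_norm_sq_to_K, hz]; simp
  rw [op_one_eq_vecMulVec h1, Matrix.trace_vecMulVec, ← h, EuclideanSpace.inner_eq_star_dotProduct]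

variable [NeZero d]

/-- The probability of eventually seeing only the outcome `a` is the limit of the probabilities of
the strings `a ⋯ a`. -/
theorem IsPVM.tendsto_trace_pow {k : ℕ} {M : POVM d k} (hM : M.IsPVM)
    (U : Matrix.unitaryGroup (Fin d) ℂ) (a : Fin k) :
    Tendsto (fun m : ℕ => (d : ℂ)⁻¹ * ((M.op a * U.1) ^ m * star (M.op a * U.1) ^ m).trace) atTop
      (𝓝 ((M.outcomeMeasure U).real {s | ∀ᶠ n in atTop, s n = a} : ℂ)) := by
  rw [Measure.real, measure_eventually_eq (M.measurePreserving_shift U)]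
  have h := (ENNReal.tendsto_toReal (measure_ne_top (M.outcomeMeasure U) _)).comp
    (tendsto_measure_cylinder_replicate (M.outcomeMeasure U) a)
  refine ((Complex.continuous_ofReal.tendsto _).comp h).congr fun m => ?_
  rw [← hM.stringProb_replicate U a m]
  simp only [Function.comp_apply, outcomeMeasure_cylinder]
  rw [ENNReal.toReal_ofReal (M.stringProb_nonneg U _)]

/-- If no eigenvector of `U` is orthogonal to `z`, the outcome measure is ergodic. -/
theorem IsPVM.ergodic_outcomeMeasure (hM : M.IsPVM) (U : Matrix.unitaryGroup (Fin d) ℂ)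
    (hz : ‖z‖ = 1) (h1 : ∀ x, Matrix.toEuclideanLin (M.op 1) x = ⟪z, x⟫_ℂ • z)
    (hU : ∀ v ∈ (Submodule.span ℂ {z})ᗮ, ∀ μ : ℂ,
      ¬ Module.End.HasEigenvector (Matrix.toEuclideanLin U.1) μ v) :
    Ergodic shift (M.outcomeMeasure U) := by
  have hd0 : (0 : ℝ) < (d : ℝ)⁻¹ := inv_pos.2 (Nat.cast_pos.2 (NeZero.pos d))
  have htr := trace_op_one hz h1
  refine ergodic_shift_of_regenerative (M.measurePreserving_shift U) ?_ (fun ι κ => ?_) ?_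
  · have : M.stringProb U (maxMixed d) [1] = (d : ℝ)⁻¹ := by
      rw [stringProb, List.foldl_cons, List.foldl_nil, hM.evolve_maxMixed, Matrix.trace_smul, htr,
        smul_eq_mul, mul_one, ← Complex.ofReal_natCast, ← Complex.ofReal_inv, Complex.ofReal_re]
    rw [outcomeMeasure_cylinder, this]
    exact (ENNReal.ofReal_pos.2 hd0).ne'
  · simp only [outcomeMeasure_cylinder]
    rw [← ENNReal.ofReal_mul (M.stringProb_nonneg U _),
      ← ENNReal.ofReal_mul (M.stringProb_nonneg U _),
      hM.stringProb_append_cons U (op_one_eq_vecMulVec h1) htr]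
  · have hpow : Tendsto (fun m : ℕ => (M.op 0 * U.1) ^ m) atTop (𝓝 0) := by
      -- An eigenvalue of `Π₁U` of modulus at least one would yield an eigenvector of `U` orthogonal
      -- to `z`, which `hU` excludes.
      refine Matrix.tendsto_pow_atTop_nhds_zero _ fun μ v hv => ?_
      by_contra! hμ
      have h := hv.apply_eq_smul
      rw [Matrix.toEuclideanLin_mul_apply, toEuclideanLin_op_zero, h1] at h
      obtain ⟨hvz, hev⟩ := hasEigenvector_of_compression
        (Matrix.inner_toEuclideanLin_unitary U) hz hv.2 hμ h
      exact hU v hvz μ hev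
    have hlim : Tendsto
        (fun m : ℕ => (d : ℂ)⁻¹ * ((M.op 0 * U.1) ^ m * star (M.op 0 * U.1) ^ m).trace)
        atTop (𝓝 0) := by
      have hc : Continuous fun B : Matrix (Fin d) (Fin d) ℂ =>
          (d : ℂ)⁻¹ * (B * star B).trace :=
        continuous_const.mul (continuous_id.matrix_mul continuous_star).matrix_trace
      have := (hc.tendsto 0).comp hpow
      simpa [Function.comp_def, star_pow] using this
    have h0 := tendsto_nhds_unique hlim (hM.tendsto_trace_pow U 0)
    rw [← measure_eventually_eq (M.measurePreserving_shift U), ← measureReal_eq_zero_iff]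
    exact_mod_cast h0.symm

/-- If an eigenvector of `U` is orthogonal to `z`, the outcome measure is not ergodic: with a
probability strictly between zero and one, the outcome is eventually constant. -/
theorem IsPVM.not_ergodic_outcomeMeasure (hM : M.IsPVM) (U : Matrix.unitaryGroup (Fin d) ℂ)
    (hz : ‖z‖ = 1) (h1 : ∀ x, Matrix.toEuclideanLin (M.op 1) x = ⟪z, x⟫_ℂ • z)
    {v : EuclideanSpace ℂ (Fin d)} (hvz : v ∈ (Submodule.span ℂ {z})ᗮ) {μ : ℂ}
    (hv : Module.End.HasEigenvector (Matrix.toEuclideanLin U.1) μ v) :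
    ¬ Ergodic shift (M.outcomeMeasure U) := by
  have hd0 : (0 : ℝ) < (d : ℝ)⁻¹ := inv_pos.2 (Nat.cast_pos.2 (NeZero.pos d))
  set E : Set (ℕ → Fin 2) := {s | ∀ᶠ n in atTop, s n = 0} with hE
  have hμ : ‖μ‖ = 1 :=
    norm_eigenvalue_of_inner_map_map (Matrix.inner_toEuclideanLin_unitary U) hv
  -- `U v = μ v` stays orthogonal to `z`, so `Π₁` fixes it.
  have hA : Matrix.toEuclideanLin (M.op 0 * U.1) v = μ • v := by
    rw [Matrix.toEuclideanLin_mul_apply, hv.apply_eq_smul, toEuclideanLin_op_zero, h1,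
      inner_smul_right, Submodule.mem_orthogonal_singleton_iff_inner_right.1 hvz]
    simp
  have hAm (m : ℕ) : Matrix.toEuclideanLin ((M.op 0 * U.1) ^ m) v = μ ^ m • v := by
    induction m with
    | zero => simp
    | succ m ih => rw [pow_succ, Matrix.toEuclideanLin_mul_apply, hA, map_smul, ih, smul_smul,
        pow_succ']
  -- `(Π₁U) ^ m` preserves `‖v‖`, so its squared Hilbert–Schmidt norm, which is the trace in the
  -- limit formula, is at least one for every `m`.
  have hlow : (d : ℝ)⁻¹ ≤ (M.outcomeMeasure U).real E := by
    have hlim := (Complex.continuous_re.tendsto _).comp (hM.tendsto_trace_pow U 0)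
    refine ge_of_tendsto' hlim fun m => ?_
    have hle := Matrix.norm_sq_toEuclideanLin_le ((M.op 0 * U.1) ^ m) v
    rw [hAm, norm_smul, norm_pow, hμ, one_pow, one_mul] at hle
    have hpos : 0 < ‖v‖ ^ 2 := pow_pos (norm_pos_iff.2 hv.2) 2
    have h1 := (le_mul_iff_one_le_left hpos).1 hle
    rw [Function.comp_apply, ← Complex.ofReal_natCast, ← Complex.ofReal_inv,
      Complex.re_ofReal_mul, ← star_pow]
    exact le_mul_of_one_le_right hd0.le h1
  have hmark : M.outcomeMeasure U (cylinder [1]) ≠ 0 := by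
    rw [outcomeMeasure_cylinder, stringProb, List.foldl_cons, List.foldl_nil, hM.evolve_maxMixed,
      Matrix.trace_smul, trace_op_one hz h1, smul_eq_mul, mul_one, ← Complex.ofReal_natCast,
      ← Complex.ofReal_inv, Complex.ofReal_re]
    exact (ENNReal.ofReal_pos.2 hd0).ne'
  have hEm : MeasurableSet E := by
    have : E = ⋃ m, ⋂ n, ⋂ (_ : m ≤ n), (fun s => s n) ⁻¹' {0} := by
      ext s; simp [hE]
    rw [this]
    exact MeasurableSet.iUnion fun m => MeasurableSet.iInter fun n => MeasurableSet.iInter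
      fun _ => (measurableSet_singleton 0).preimage (measurable_pi_apply n)
  have hEinv : shift ⁻¹' E = E := by
    ext s
    simp only [hE, Set.mem_preimage, Set.mem_ofPred_eq, shift]
    conv_rhs => rw [← map_add_atTop_eq_nat 1, eventually_map]
  intro herg
  -- Probability zero contradicts `hlow`; probability one would make the constant sequence `0`
  -- almost sure, against `hmark`.
  rcases herg.toPreErgodic.measure_self_or_compl_eq_zero hEm hEinv with h | h
  · rw [Measure.real, h] at hlow
    exact absurd hlow (by simpa using NeZero.ne d)
  · have hE1 := (prob_compl_eq_zero_iff hEm).1 h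
    rw [measure_eventually_eq (M.measurePreserving_shift U),
      ← prob_compl_eq_zero_iff (measurableSet_forall_eq 0)] at hE1
    refine hmark (measure_mono_null (fun s hs => ?_) hE1)
    rw [mem_cylinder_singleton] at hs
    intro h0
    simp [h0 0] at hs

end RepeatedMeasurement.POVM

/-! ### The main theorem -/

theorem theorem14 {d : ℕ} [NeZero d] (hd : 2 ≤ d) (U : Matrix.unitaryGroup (Fin d) ℂ)
    (M : RepeatedMeasurement.POVM d 2) (hM : M.IsPVM)
    (hrank₁ : (M.op 0).rank = d - 1) (hrank₂ : (M.op 1).rank = 1)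
    (z : EuclideanSpace ℂ (Fin d)) (hz : ‖z‖ = 1)
    (hspan : LinearMap.range (Matrix.toEuclideanLin (M.op 1)) = Submodule.span ℂ {z})
    (Θ : Submodule ℂ (EuclideanSpace ℂ (Fin d)))
    (hΘ : Θ = LinearMap.range (Matrix.toEuclideanLin (M.op 0))) :
    Θ = (Submodule.span ℂ {z})ᗮ ∧
    List.TFAE [
      ¬ Ergodic RepeatedMeasurement.shift (M.outcomeMeasure U),
      ∃ W : Submodule ℂ (EuclideanSpace ℂ (Fin d)), W ≠ ⊥ ∧ W ≠ ⊤ ∧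
        W ∈ Module.End.invtSubmodule (Matrix.toEuclideanLin U.1) ∧
        W ∈ Module.End.invtSubmodule (Matrix.toEuclideanLin (M.op 1)),
      ∃ W : Submodule ℂ (EuclideanSpace ℂ (Fin d)), W ≠ ⊥ ∧ W ≠ ⊤ ∧
        W ∈ Module.End.invtSubmodule (Matrix.toEuclideanLin U.1) ∧ z ∈ W,
      ∃ v ∈ Θ, ∃ μ : ℂ, Module.End.HasEigenvector (Matrix.toEuclideanLin U.1) μ v] ∧
    (∀ W : Submodule ℂ (EuclideanSpace ℂ (Fin d)),
      W ∈ Module.End.invtSubmodule (Matrix.toEuclideanLin (M.op 1)) →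
        W ∈ Module.End.invtSubmodule (Matrix.toEuclideanLin (M.op 0))) ∧
    Tendsto (fun m : ℕ => (d : ℂ)⁻¹ * ((M.op 0 * U.1) ^ m * star (M.op 0 * U.1) ^ m).trace) atTop
      (𝓝 ((M.outcomeMeasure U).real {s | ∀ᶠ n in atTop, s n = 0} : ℂ)) := by
  have hidem (x : EuclideanSpace ℂ (Fin d)) : Matrix.toEuclideanLin (M.op 1)
      (Matrix.toEuclideanLin (M.op 1) x) = Matrix.toEuclideanLin (M.op 1) x := by
    rw [← Matrix.toEuclideanLin_mul_apply, (hM 1).eq]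
  have hsymm := (Matrix.isPositive_toEuclideanLin_iff.2 (M.posSemidef 1)).isSymmetric
  have h1 := hsymm.apply_eq_inner_smul hidem hz hspan
  have hΘz : Θ = (Submodule.span ℂ {z})ᗮ := hΘ.trans (RepeatedMeasurement.POVM.range_op_zero hz h1)
  have hz0 : z ≠ 0 := norm_ne_zero_iff.1 (by simp [hz])
  have htfae := tfae_invtSubmodule_rankOne (Matrix.inner_toEuclideanLin_unitary U) hz0 h1
  refine ⟨hΘz, ?_, fun W hW x hx => ?_, hM.tendsto_trace_pow U 0⟩
  · rw [hΘz]
    tfae_have 2 ↔ 3 := htfae.out 0 1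
    tfae_have 3 ↔ 4 := htfae.out 1 2
    tfae_have 4 → 1 := by
      rintro ⟨v, hv, μ, h⟩
      exact hM.not_ergodic_outcomeMeasure U hz h1 hv h
    tfae_have 1 → 4 := by
      intro h
      by_contra! hU
      exact h (hM.ergodic_outcomeMeasure U hz h1 hU)
    tfae_finish
  · rw [Submodule.mem_comap, RepeatedMeasurement.POVM.toEuclideanLin_op_zero]
    exact W.sub_mem hx (hW hx)
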